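/- Let $n\ge 3$, let $T$ be the set of transpositions of the symmetric group $\mathfrak S_n$ and let $c=(1\ 2\ \cdots\ n)$; permutations are composed from right to left. For $w\in\mathfrak S_n$ let $\ell_T(w)$ be the least number of transpositions whose product is $w$, and let $\le_T$ be the absolute order: $u\le_T w$ if and only if $\ell_T(w)=\ell_T(u)+\ell_T(u^{-1}w)$. Let $NC(\mathfrak S_n,c)=\{v\in\mathfrak S_n : e\le_T v\le_T c\}$, which is a lattice under $\le_T$ and contains $T$. Let the noncrossing projection $\pi_T(w)$ be the join, in $NC(\mathfrak S_n,c)$, of all $t\in T$ with $t\le_T w$, and put $\mathrm{Pop}_T(w)=w\cdot\pi_T(w)^{-1}$. The forward orbit of $w$ is $O_{\mathrm{Pop}_T}(w)=\{w,\mathrm{Pop}_T(w),\mathrm{Pop}_T^2(w),\dots\}$. An antiexceedance of $w$ is an $i\in\{1,\dots,n\}$ with $i<w^{-1}(i)$, and $w$ is called $A$-splittable if it has exactly $n-2$ antiexceedances and $\pi_T(w)$ has exactly one non-singleton cycle. Then a permutation $w\in\mathfrak S_n$ satisfies $|O_{\mathrm{Pop}_T}(w)|=n-1$ if and only if $w$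 is $A$-splittable. In particular, the number of $w\in\mathfrak S_n$ with $|O_{\mathrm{Pop}_T}(w)|=n-1$ is $2^n-\binom n2-1$. -/

import Mathlib

/-- The word length `ℓ_T(w)`: the least length of an expression of `w` as a product of
elements of `T`. -/
noncomputable def reflLength {G : Type*} [Group G] (T : Set G) (w : G) : ℕ :=
  sInf {k : ℕ | ∃ l : List G, (∀ t ∈ l, t ∈ T) ∧ l.prod = w ∧ l.length = k}

/-- The absolute order: `u ≤_T w` iff `ℓ_T(w) = ℓ_T(u) + ℓ_T(u⁻¹ w)`. -/
def AbsLE {G : Type*} [Group G] (T : Set G) (u w : G) : Prop :=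
  reflLength T w = reflLength T u + reflLength T (u⁻¹ * w)

/-- The noncrossing partitions relative to `c`: the interval `[e, c]` of the absolute order. -/
def NC {G : Type*} [Group G] (T : Set G) (c : G) : Set G :=
  {v | AbsLE T 1 v ∧ AbsLE T v c}

/-- `v` is the join, in the poset `NC T c`, of a set `X` of group elements. -/
def IsNCJoin {G : Type*} [Group G] (T : Set G) (c : G) (X : Set G) (v : G) : Prop :=
  v ∈ NC T c ∧ (∀ t ∈ X, AbsLE T t v) ∧
    ∀ u ∈ NC T c, (∀ t ∈ X, AbsLE T t u) → AbsLE T v u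

open Classical in
/-- The noncrossing projection `π_T(w)`: the join in `NC T c` of all `t ∈ T` with `t ≤_T w`.
For a finite Coxeter group with reflections `T` and Coxeter element `c` the poset `NC T c` is a
lattice containing `T`, so the join exists; the value `1` is used for other data only. -/
noncomputable def ncProj {G : Type*} [Group G] (T : Set G) (c w : G) : G :=
  if h : ∃ v, IsNCJoin T c {t | t ∈ T ∧ AbsLE T t w} v then h.choose else 1

/-- Coxeter pop-tsack torsing: `Pop_T(w) = w · π_T(w)⁻¹`. -/
noncomputable def popT {G : Type*} [Group G] (T : Set G) (c w : G) : G :=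
  w * (ncProj T c w)⁻¹

/-- The forward orbit `{x, f x, f (f x), …}`. -/
def forwardOrbit {X : Type*} (f : X → X) (x : X) : Set X :=
  Set.range fun k : ℕ => f^[k] x

/-- The reflections of the symmetric group: all transpositions. -/
def transpositions (n : ℕ) : Set (Equiv.Perm (Fin n)) :=
  {t | t.IsSwap}

/-- The noncrossing projection on the symmetric group for the Coxeter element
`c = (1 2 ⋯ n)`, which is `finRotate n` on the ground set `Fin n = {0, …, n - 1}`. -/
noncomputable def ncProjA {n : ℕ} (w : Equiv.Perm (Fin n)) : Equiv.Perm (Fin n) :=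
  ncProj (transpositions n) (finRotate n) w

/-- Pop-tsack torsing on the symmetric group for the Coxeter element `c = (1 2 ⋯ n)`. -/
noncomputable def popTA {n : ℕ} (w : Equiv.Perm (Fin n)) : Equiv.Perm (Fin n) :=
  popT (transpositions n) (finRotate n) w

/-- The number of antiexceedances: indices `i` with `i < w⁻¹(i)`. -/
def aexc {n : ℕ} (w : Equiv.Perm (Fin n)) : ℕ :=
  (Finset.univ.filter fun i : Fin n => i < w⁻¹ i).card

/-- The number of non-singleton cycles. -/
def cyc {n : ℕ} (w : Equiv.Perm (Fin n)) : ℕ :=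
  w.cycleFactorsFinset.card

/-- `w` has exactly `n - 2` antiexceedances and `π_T(w)` has exactly one non-singleton cycle. -/
def ASplittable {n : ℕ} (w : Equiv.Perm (Fin n)) : Prop :=
  (aexc w : ℤ) = (n : ℤ) - 2 ∧ cyc (ncProjA w) = 1

/-!
Place the `n` points on a circle. The noncrossing projection `π` of `w` traverses the blocks of
the finest noncrossing partition coarser than the cycles of `w`, so on the way forward from `x`
to `w x` one meets `π x`; measuring distances forward around the circle and summing over `x`
gives `aexc (Pop w) + aexc π = aexc w`. Since `aexc` vanishes only at the identity, an orbit has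
at most `aexc w + 1` elements, with equality if and only if every projection along it has
exactly one antiexceedance, that is, is a single cycle running once forward around the circle.

Write `w⁻¹ = c * s`; then `aexc w + aexc s = n - 1`. If `s = 1`, the orbit has `n` elements. An
orbit with `n - 1` elements therefore requires `aexc w = n - 2`, hence `aexc s = 1`, and a first
projection that is a single cycle: `w` is `A`-splittable, and `s` is the increasing cycle
through a set `S`. If `S = {b, b'}` with `b` and `b'` not adjacent, then `w` preserves the two
arcs between them and its projection is not a single cycle. In all other cases, every inversion
of the lift of `w⁻¹` to the universal cover of the circle starts at a point of `S` and ends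
before the next one. This persists under `Pop`, which only removes inversions, and it forces
each projection along the orbit to be a single cycle, so that the orbit has `aexc w + 1 = n - 1`
elements. Hence the permutations in question correspond to the sets `S` with at least three
elements and the `n` adjacent pairs.
-/

namespace PopTsack

section AbsoluteOrder

variable {G : Type*} [Group G] {T : Set G}

lemma reflLength_prod_le {l : List G} (hl : ∀ t ∈ l, t ∈ T) : reflLength T l.prod ≤ l.length :=
  Nat.sInf_le ⟨l, hl, rfl, rfl⟩

lemma reflLength_one : reflLength T (1 : G) = 0 :=
  Nat.le_zero.mp (reflLength_prod_le (l := []) (by simp))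

lemma reflLength_le_one {t : G} (ht : t ∈ T) : reflLength T t ≤ 1 := by
  simpa using reflLength_prod_le (l := [t]) (by simpa using ht)

lemma absLE_one_left (w : G) : AbsLE T 1 w := by simp [AbsLE, reflLength_one]

lemma absLE_refl (w : G) : AbsLE T w w := by simp [AbsLE, reflLength_one]

lemma exists_reduced_list (hT : Submonoid.closure T = ⊤) (w : G) :
    ∃ l : List G, (∀ t ∈ l, t ∈ T) ∧ l.prod = w ∧ l.length = reflLength T w := by
  obtain ⟨l, hl, hw⟩ := Submonoid.exists_list_of_mem_closure (hT ▸ Submonoid.mem_top w)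
  exact Nat.sInf_mem (s := {k | ∃ l : List G, (∀ t ∈ l, t ∈ T) ∧ l.prod = w ∧ l.length = k})
    ⟨l.length, l, hl, hw, rfl⟩

lemma eq_one_of_reflLength_eq_zero (hT : Submonoid.closure T = ⊤) {w : G}
    (h : reflLength T w = 0) : w = 1 := by
  obtain ⟨l, -, rfl, hlen⟩ := exists_reduced_list hT w
  rw [List.eq_nil_of_length_eq_zero (hlen.trans h), List.prod_nil]

lemma reflLength_mul_le (hT : Submonoid.closure T = ⊤) (u v : G) :
    reflLength T (u * v) ≤ reflLength T u + reflLength T v := by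
  obtain ⟨l, hl, rfl, hlen⟩ := exists_reduced_list hT u
  obtain ⟨l', hl', rfl, hlen'⟩ := exists_reduced_list hT v
  rw [← hlen, ← hlen', ← List.length_append, ← List.prod_append]
  exact reflLength_prod_le fun t ht => (List.mem_append.mp ht).elim (hl t) (hl' t)

lemma exists_eq_mul_of_reflLength_eq_succ (hT : Submonoid.closure T = ⊤) {w : G} {k : ℕ}
    (h : reflLength T w = k + 1) : ∃ v, ∃ t ∈ T, w = v * t ∧ reflLength T v = k := by
  obtain ⟨l, hl, rfl, hlen⟩ := exists_reduced_list hT w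
  obtain ⟨l, t, rfl⟩ := l.eq_nil_or_concat.resolve_left (by rintro rfl; simp_all)
  rw [List.concat_eq_append] at *
  have ht : t ∈ T := hl t (by simp)
  have hprod : (l ++ [t]).prod = l.prod * t := by simp
  refine ⟨l.prod, t, ht, hprod, ?_⟩
  have hle : reflLength T l.prod ≤ l.length := reflLength_prod_le fun s hs => hl s (by simp [hs])
  have hmul := reflLength_mul_le hT l.prod t
  have := reflLength_le_one ht
  rw [← hprod] at hmul
  rw [List.length_append, List.length_singleton] at hlen
  omega

lemma absLE_antisymm (hT : Submonoid.closure T = ⊤) {u v : G} (huv : AbsLE T u v)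
    (hvu : AbsLE T v u) : u = v := by
  unfold AbsLE at huv hvu
  exact inv_mul_eq_one.mp (eq_one_of_reflLength_eq_zero hT (by omega))

lemma isNCJoin_unique (hT : Submonoid.closure T = ⊤) {X : Set G} {c u v : G}
    (hu : IsNCJoin T c X u) (hv : IsNCJoin T c X v) : u = v :=
  absLE_antisymm hT (hu.2.2 v hv.1 hv.2.1) (hv.2.2 u hu.1 hu.2.1)

lemma absLE_mul_right (hT : Submonoid.closure T = ⊤) {u v t : G} (h : AbsLE T u v) (ht : t ∈ T)
    (hvt : reflLength T (v * t) = reflLength T v + 1) : AbsLE T u (v * t) := by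
  have hsub := reflLength_mul_le hT u (u⁻¹ * (v * t))
  have hadd := reflLength_mul_le hT (u⁻¹ * v) t
  rw [mul_inv_cancel_left] at hsub
  rw [mul_assoc] at hadd
  have := reflLength_le_one ht
  unfold AbsLE at h ⊢
  omega

lemma absLE_downward_induction (hT : Submonoid.closure T = ⊤) {P : G → Prop}
    (hcover : ∀ v, ∀ t ∈ T, reflLength T (v * t) = reflLength T v + 1 → P (v * t) → P v)
    {u w : G} (h : AbsLE T u w) (hw : P w) : P u := by
  induction hk : reflLength T (u⁻¹ * w) generalizing w with
  | zero => rwa [inv_mul_eq_one.mp (eq_one_of_reflLength_eq_zero hT hk)]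
  | succ k ih =>
    obtain ⟨v, t, ht, hvt, hv⟩ := exists_eq_mul_of_reflLength_eq_succ hT hk
    obtain rfl : w = u * v * t := by rw [mul_assoc, ← hvt, mul_inv_cancel_left]
    have huv := reflLength_mul_le hT u v
    have huvt := reflLength_mul_le hT (u * v) t
    have := reflLength_le_one ht
    unfold AbsLE at h
    have hdiff : u⁻¹ * (u * v) = v := inv_mul_cancel_left u v
    refine ih ?_ (hcover _ t ht (by omega) hw) (by rw [hdiff, hv])
    unfold AbsLE
    rw [hdiff]
    omega

end AbsoluteOrder

open Equiv Equiv.Perm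

section Cycles

variable {α : Type*}

lemma sameCycle_self_apply (w : Perm α) (x : α) : w.SameCycle x (w x) :=
  (SameCycle.refl w x).apply_right

variable [Finite α]

lemma rel_of_sameCycle {w : Perm α} {r : Setoid α} (h : ∀ y, r y (w y)) {y z : α}
    (hyz : w.SameCycle y z) : r y z := by
  obtain ⟨k, rfl⟩ := hyz.exists_nat_pow_eq
  clear hyz
  induction k with
  | zero => exact r.refl y
  | succ k ih => rw [pow_succ', mul_apply]; exact r.trans ih (h _)

lemma mem_of_sameCycle {w : Perm α} {A : Set α} (h : Set.MapsTo w A A) {y z : α}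
    (hyz : w.SameCycle y z) (hy : y ∈ A) : z ∈ A := by
  obtain ⟨k, rfl⟩ := hyz.exists_nat_pow_eq
  exact h.perm_pow k hy

end Cycles

section SwapCycles

variable {α : Type*} [DecidableEq α] {w : Perm α} {x y : α}

lemma mul_swap_apply_of_ne_of_ne {z : α} (hx : z ≠ x) (hy : z ≠ y) :
    (w * swap x y) z = w z := by
  rw [mul_apply, swap_apply_of_ne_of_ne hx hy]

variable [Finite α]

lemma sameCycle_mul_swap_of_not (h : ¬ w.SameCycle x y) : (w * swap x y).SameCycle x y := by
  by_contra hcon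
  have hx : (w * swap x y) x = w y := by simp
  refine hcon (mem_of_sameCycle (w := w) (A := {z | (w * swap x y).SameCycle x z ∧ w.SameCycle y z})
    ?_ (sameCycle_self_apply w y).symm ⟨hx ▸ sameCycle_self_apply _ x, sameCycle_self_apply w y⟩).1
  rintro z ⟨hxz, hyz⟩
  have hz : (w * swap x y) z = w z :=
    mul_swap_apply_of_ne_of_ne (by rintro rfl; exact h hyz.symm) (by rintro rfl; exact hcon hxz)
  exact ⟨hz ▸ hxz.apply_right, hyz.apply_right⟩

/-- The orbit of `y` under `w * swap x y` is the segment `w y, …, x` of its `w`-cycle, which does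
not contain `y`. -/
lemma not_sameCycle_mul_swap (hne : x ≠ y) (h : w.SameCycle x y) :
    ¬ (w * swap x y).SameCycle x y := by
  obtain ⟨k, hk, -, hx⟩ := h.symm.exists_pow_eq''
  have hex : ∃ j, (w ^ (j + 1)) y = x := ⟨k - 1, by rwa [Nat.sub_add_cancel hk]⟩
  obtain ⟨j, hj, hmin⟩ : ∃ j, (w ^ (j + 1)) y = x ∧ ∀ i < j, (w ^ (i + 1)) y ≠ x :=
    ⟨Nat.find hex, Nat.find_spec hex, fun i hi => Nat.find_min hex hi⟩
  set A : Set α := {z | ∃ i ≤ j, (w ^ (i + 1)) y = z} with hA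
  have hyA : y ∉ A := by
    rintro ⟨i, hi, hiy⟩
    obtain rfl | hlt := hi.eq_or_lt
    · exact hne (hj.symm.trans hiy)
    · refine hmin (j - i - 1) (by omega) ?_
      rw [← hj, show j + 1 = (j - i - 1 + 1) + (i + 1) by omega, pow_add w _ (i + 1), mul_apply,
        hiy]
  have hmaps : Set.MapsTo (w * swap x y) A A := by
    rintro z ⟨i, hi, rfl⟩
    obtain rfl | hlt := hi.eq_or_lt
    · exact ⟨0, Nat.zero_le _, by simp [hj]⟩
    · have hzy : (w ^ (i + 1)) y ≠ y := fun hz => hyA ⟨i, hi, hz⟩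
      refine ⟨i + 1, hlt, ?_⟩
      rw [mul_swap_apply_of_ne_of_ne (hmin i hlt) hzy, pow_succ' w (i + 1), mul_apply]
  exact fun hcon => hyA (mem_of_sameCycle hmaps hcon ⟨j, le_rfl, hj⟩)

end SwapCycles

section NumCycles

variable {α : Type*}

open Classical in
/-- The partition obtained from `r` by merging the classes of `x` and `y`. -/
noncomputable def mergeClasses (r : Setoid α) (x y : α) : Setoid α :=
  Setoid.ker fun a => if r x a then (⟦y⟧ : Quotient r) else ⟦a⟧

lemma mergeClasses_of_rel {r : Setoid α} (x y : α) {a b : α} (h : r a b) :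
    mergeClasses r x y a b := by
  classical
  change (if r x a then _ else _) = if r x b then _ else _
  rw [Quotient.sound h, (⟨fun hx => r.trans hx h, fun hx => r.trans hx (r.symm h)⟩ : r x a ↔ r x b)]

lemma mergeClasses_self (r : Setoid α) (x y : α) : mergeClasses r x y x y := by
  classical
  change (if r x x then _ else _) = if r x y then _ else _
  rw [if_pos (r.refl x), ite_self]

lemma mergeClasses_le {r s : Setoid α} {x y : α} (hrs : r ≤ s) (hxy : s x y) :
    mergeClasses r x y ≤ s := by
  classical
  have hrep : ∀ a, ∃ c, (if r x a then (⟦y⟧ : Quotient r) else ⟦a⟧) = ⟦c⟧ ∧ s a c := fun a => by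
    split_ifs with h
    · exact ⟨y, rfl, s.trans (s.symm (hrs h)) hxy⟩
    · exact ⟨a, rfl, s.refl a⟩
  intro a b hab
  obtain ⟨c, hc, hac⟩ := hrep a
  obtain ⟨d, hd, hbd⟩ := hrep b
  have hcd : r c d := Quotient.exact (hc.symm.trans (Eq.trans hab hd))
  exact s.trans hac (s.trans (hrs hcd) (s.symm hbd))

lemma card_quotient_mergeClasses [Finite α] {r : Setoid α} {x y : α} (h : ¬ r x y) :
    Nat.card (Quotient (mergeClasses r x y)) + 1 = Nat.card (Quotient r) := by
  classical
  have hrange : Set.range (fun a => if r x a then (⟦y⟧ : Quotient r) else ⟦a⟧) = {⟦x⟧}ᶜ := by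
    ext q
    induction q using Quotient.inductionOn with | _ a
    simp only [Set.mem_range, Set.mem_compl_iff, Set.mem_singleton_iff, Quotient.eq]
    constructor
    · rintro ⟨b, hb⟩ hax
      split_ifs at hb with hxb
      · exact h (r.symm (r.trans (Quotient.exact hb) hax))
      · exact hxb (r.symm (r.trans (Quotient.exact hb) hax))
    · exact fun hax => ⟨a, if_neg fun hxa => hax (r.symm hxa)⟩
  rw [mergeClasses, Nat.card_congr (Setoid.quotientKerEquivRange _), hrange, Nat.card_coe_set_eq,
    ← Set.ncard_singleton (⟦x⟧ : Quotient r), add_comm, Set.ncard_add_ncard_compl]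

/-- The number of cycles of `w`, fixed points included. -/
noncomputable def numCycles (w : Perm α) : ℕ := Nat.card (Quotient (SameCycle.setoid w))

lemma numCycles_one : numCycles (1 : Perm α) = Nat.card α :=
  Nat.card_congr
    ⟨Quotient.lift id fun _ _ => sameCycle_one.mp, Quotient.mk _, by rintro ⟨_⟩; rfl, fun _ => rfl⟩

lemma numCycles_le [Finite α] (w : Perm α) : numCycles w ≤ Nat.card α :=
  Nat.card_le_card_of_surjective _ Quotient.mk_surjective

variable [DecidableEq α] {w : Perm α} {x y : α}

lemma rel_swap_apply {r : Setoid α} (h : r x y) (a : α) : r a (swap x y a) := by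
  rcases eq_or_ne a x with rfl | hx
  · rwa [swap_apply_left]
  rcases eq_or_ne a y with rfl | hy
  · rw [swap_apply_right]; exact r.symm h
  · rw [swap_apply_of_ne_of_ne hx hy]

variable [Finite α]

lemma setoid_mul_swap_of_not (h : ¬ w.SameCycle x y) :
    SameCycle.setoid (w * swap x y) = mergeClasses (SameCycle.setoid w) x y := by
  have hxy : (w * swap x y).SameCycle x y := sameCycle_mul_swap_of_not h
  refine le_antisymm (fun a b => rel_of_sameCycle fun a => ?_) (mergeClasses_le (fun a b => ?_) hxy)
  · exact (mergeClasses _ x y).trans (rel_swap_apply (mergeClasses_self _ x y) a)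
      (mergeClasses_of_rel x y (sameCycle_self_apply w _))
  · refine rel_of_sameCycle (r := SameCycle.setoid (w * swap x y)) fun a => ?_
    have ha : (w * swap x y).SameCycle a (swap x y a) :=
      rel_swap_apply (r := SameCycle.setoid (w * swap x y)) hxy a
    have hwa : (w * swap x y) (swap x y a) = w a := by simp
    exact hwa ▸ ha.apply_right

lemma numCycles_mul_swap_of_not (h : ¬ w.SameCycle x y) :
    numCycles (w * swap x y) + 1 = numCycles w := by
  rw [numCycles, setoid_mul_swap_of_not h]
  exact card_quotient_mergeClasses h

lemma numCycles_mul_swap (hne : x ≠ y) (h : w.SameCycle x y) :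
    numCycles (w * swap x y) = numCycles w + 1 := by
  simpa using (numCycles_mul_swap_of_not (not_sameCycle_mul_swap hne h)).symm

end NumCycles

section ReflLength

variable {α : Type*} [DecidableEq α]

/-- The transpositions of an arbitrary type. -/
abbrev swaps (α : Type*) [DecidableEq α] : Set (Perm α) := {t | t.IsSwap}

lemma swap_mem_swaps {x y : α} (hne : x ≠ y) : swap x y ∈ swaps α := ⟨x, y, hne, rfl⟩

variable [Finite α] {w : Perm α} {x y : α}

lemma closure_swaps : Submonoid.closure (swaps α) = ⊤ := mclosure_isSwap

lemma card_le_numCycles_prod_add_length {l : List (Perm α)} (hl : ∀ t ∈ l, t ∈ swaps α) :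
    Nat.card α ≤ numCycles l.prod + l.length := by
  induction l using List.reverseRecOn with
  | nil => simp [numCycles_one]
  | append_singleton l t ih =>
    obtain ⟨x, y, hne, rfl⟩ := hl t (by simp)
    have hcard := ih fun s hs => hl s (by simp [hs])
    rw [List.prod_append, List.prod_singleton, List.length_append, List.length_singleton]
    by_cases h : l.prod.SameCycle x y
    · have := numCycles_mul_swap hne h; omega
    · have := numCycles_mul_swap_of_not h; omega

lemma reflLength_add_numCycles_le (w : Perm α) :
    reflLength (swaps α) w + numCycles w ≤ Nat.card α := by
  induction hk : Nat.card α - numCycles w using Nat.strong_induction_on generalizing w with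
  | _ k ih =>
    obtain rfl | hw := eq_or_ne w 1
    · rw [reflLength_one, numCycles_one, zero_add]
    obtain ⟨x, hx⟩ : ∃ x, w x ≠ x := by
      by_contra! hfix
      exact hw (Equiv.ext hfix)
    set v := w * swap x (w x) with hv
    have hvw : v * swap x (w x) = w := by simp [hv]
    have hcycles : numCycles v = numCycles w + 1 :=
      numCycles_mul_swap hx.symm (sameCycle_self_apply w x)
    have := numCycles_le v
    have := ih _ (by omega) v rfl
    have hmul := reflLength_mul_le closure_swaps v (swap x (w x))
    have := reflLength_le_one (swap_mem_swaps hx.symm)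
    rw [hvw] at hmul
    omega

lemma reflLength_add_numCycles (w : Perm α) :
    reflLength (swaps α) w + numCycles w = Nat.card α := by
  refine (reflLength_add_numCycles_le w).antisymm ?_
  obtain ⟨l, hl, rfl, hlen⟩ := exists_reduced_list closure_swaps w
  rw [← hlen, add_comm]
  exact card_le_numCycles_prod_add_length hl

lemma reflLength_mul_swap (hne : x ≠ y) (h : w.SameCycle x y) :
    reflLength (swaps α) (w * swap x y) + 1 = reflLength (swaps α) w := by
  have := numCycles_mul_swap hne h
  have := reflLength_add_numCycles w
  have := reflLength_add_numCycles (w * swap x y)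
  omega

lemma reflLength_mul_swap_of_not (h : ¬ w.SameCycle x y) :
    reflLength (swaps α) (w * swap x y) = reflLength (swaps α) w + 1 := by
  have := numCycles_mul_swap_of_not h
  have := reflLength_add_numCycles w
  have := reflLength_add_numCycles (w * swap x y)
  omega

lemma reflLength_swap (hne : x ≠ y) : reflLength (swaps α) (swap x y) = 1 := by
  have hnot : ¬ (1 : Perm α).SameCycle x y := fun h => hne (sameCycle_one.mp h)
  simpa [reflLength_one] using reflLength_mul_swap_of_not hnot

lemma absLE_swap_iff (hne : x ≠ y) : AbsLE (swaps α) (swap x y) w ↔ w.SameCycle x y := by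
  have hconj : (swap x y)⁻¹ * w = w * swap (w⁻¹ x) (w⁻¹ y) := by
    rw [swap_inv, mul_swap_eq_swap_mul]; simp
  have hne' : w⁻¹ x ≠ w⁻¹ y := w⁻¹.injective.ne hne
  have hiff : w.SameCycle (w⁻¹ x) (w⁻¹ y) ↔ w.SameCycle x y :=
    sameCycle_symm_apply_left.trans sameCycle_symm_apply_right
  rw [AbsLE, reflLength_swap hne, hconj, ← hiff]
  constructor
  · intro h
    by_contra hcon
    have := reflLength_mul_swap_of_not hcon
    omega
  · intro h
    have := reflLength_mul_swap hne' h
    omega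

lemma absLE_of_absLE_mul_swap {p : Perm α} (hne : x ≠ y) (h : w.SameCycle x y)
    (hp : AbsLE (swaps α) p (w * swap x y)) : AbsLE (swaps α) p w := by
  have hlen := reflLength_mul_swap hne h
  simpa using absLE_mul_right closure_swaps hp (swap_mem_swaps hne) (by simpa using hlen.symm)

end ReflLength

variable {n : ℕ}

section CyclicDistance

/-- The cyclic distance from `x` forward to `y`, with values in `{1, …, n}`: the distance from a
point to itself is `n`, not `0`. -/
def cdist (x y : Fin n) : ℕ := if x.val < y.val then y.val - x.val else n + y.val - x.val

lemma cdist_eq_or (x y : Fin n) :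
    (x.val < y.val ∧ cdist x y + x.val = y.val) ∨
      (y.val ≤ x.val ∧ cdist x y + x.val = n + y.val) := by
  unfold cdist
  split_ifs <;> omega

lemma cdist_pos (x y : Fin n) : 0 < cdist x y := by
  have := cdist_eq_or x y
  omega

lemma cdist_le (x y : Fin n) : cdist x y ≤ n := by
  have := cdist_eq_or x y
  omega

@[simp] lemma cdist_self (x : Fin n) : cdist x x = n := by simp [cdist]

lemma cdist_right_injective (x : Fin n) : Function.Injective (cdist x) := fun y z h => by
  have := cdist_eq_or x y
  have := cdist_eq_or x z
  omega

lemma cdist_add (x y z : Fin n) :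
    (cdist x y < cdist x z ∧ cdist x y + cdist y z = cdist x z) ∨
      (cdist x z ≤ cdist x y ∧ cdist x y + cdist y z = cdist x z + n) := by
  have := cdist_eq_or x y
  have := cdist_eq_or x z
  have := cdist_eq_or y z
  omega

lemma cdist_add_comm {x y : Fin n} (hne : x ≠ y) : cdist x y + cdist y x = n := by
  have := cdist_eq_or x y
  have := cdist_eq_or y x
  have := Fin.val_ne_of_ne hne
  omega

/-- The open arc from `x` forward to `y`; `arcIoo x x` is the complement of `x`. -/
def arcIoo (x y : Fin n) : Set (Fin n) := {z | cdist x z < cdist x y}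

/-- The half-open arc from `x` (excluded) forward to `y` (included). -/
def arcIoc (x y : Fin n) : Set (Fin n) := {z | cdist x z ≤ cdist x y}

lemma mem_arcIoo {x y z : Fin n} : z ∈ arcIoo x y ↔ cdist x z < cdist x y := Iff.rfl

lemma mem_arcIoc {x y z : Fin n} : z ∈ arcIoc x y ↔ cdist x z ≤ cdist x y := Iff.rfl

end CyclicDistance

section NoncrossingPermutations

/-- Every open arc from a point `x` to its image `u x` is stable under `p`. For noncrossing `u`
and `p` this says that the cycles of `p` refine those of `u`. -/
def ArcsStable (u p : Perm (Fin n)) : Prop :=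
  ∀ x, Set.MapsTo p (arcIoo x (u x)) (arcIoo x (u x))

/-- A noncrossing permutation: its cycles run forward once around the circle, and no two of them
cross. -/
def IsNC (u : Perm (Fin n)) : Prop := ArcsStable u u

variable {u p : Perm (Fin n)} {x y z : Fin n}

lemma ArcsStable.mem_arcIoo_of_sameCycle (h : ArcsStable u p) (hyz : p.SameCycle y z)
    (hy : y ∈ arcIoo x (u x)) : z ∈ arcIoo x (u x) :=
  mem_of_sameCycle (h x) hyz hy

lemma IsNC.cdist_apply_le (h : IsNC u) (hxy : u.SameCycle x y) :
    cdist x (u x) ≤ cdist x y := by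
  by_contra! hlt
  have hx : x ∈ arcIoo x (u x) := ArcsStable.mem_arcIoo_of_sameCycle h hxy.symm hlt
  have := cdist_le x (u x)
  rw [mem_arcIoo, cdist_self] at hx
  omega

lemma exists_sameCycle_mem_arcIoo (h : ¬ u.SameCycle x z) :
    ∃ a, u.SameCycle x a ∧ z ∈ arcIoo a (u a) := by
  set a := Function.argminOn (cdist · z) {a | u.SameCycle x a} ⟨x, SameCycle.refl u x⟩
  have ha : u.SameCycle x a := Function.argminOn_mem (cdist · z) {a | u.SameCycle x a} _
  have hmin : cdist a z ≤ cdist (u a) z :=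
    Function.argminOn_le (cdist · z) {a | u.SameCycle x a} ha.apply_right
  have hne : cdist a (u a) ≠ cdist a z := fun heq =>
    h (cdist_right_injective a heq ▸ ha.apply_right)
  have := cdist_add a (u a) z
  have := cdist_pos a (u a)
  exact ⟨a, ha, mem_arcIoo.mpr (by omega)⟩

lemma IsNC.mapsTo_arcIoc (h : IsNC u) (hxy : u.SameCycle x y) :
    Set.MapsTo u (arcIoo x y) (arcIoc x y) := by
  intro a ha
  by_contra hcon
  rw [mem_arcIoo] at ha
  rw [mem_arcIoc, not_le] at hcon
  have hay := cdist_add x a y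
  have haua := cdist_add x a (u a)
  have hy : y ∈ arcIoo a (u a) := mem_arcIoo.mpr (by omega)
  have hx : cdist a x < cdist a (u a) := ArcsStable.mem_arcIoo_of_sameCycle h hxy.symm hy
  have hax := cdist_add x a x
  have := cdist_le x (u a)
  rw [cdist_self] at hax
  omega

lemma IsNC.mapsTo_mul_swap_arcIoo (h : IsNC u) (hne : x ≠ y) (hxy : u.SameCycle x y) :
    Set.MapsTo (u * swap x y) (arcIoo x (u y)) (arcIoo x (u y)) := by
  intro a ha
  rw [mem_arcIoo] at ha ⊢
  have hux := h.cdist_apply_le hxy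
  have huy := h.cdist_apply_le hxy.symm
  have hround := cdist_add_comm hne
  have hadd := cdist_add x y (u y)
  have := cdist_pos y (u y)
  have hax : a ≠ x := by
    rintro rfl
    have := cdist_le a (u y)
    rw [cdist_self] at ha
    omega
  rcases eq_or_ne a y with rfl | hay
  · rw [mul_apply, swap_apply_right]
    omega
  rw [mul_swap_apply_of_ne_of_ne hax hay]
  rcases ((cdist_right_injective x).ne hay).lt_or_gt with hbefore | hafter
  · have := mem_arcIoc.mp (h.mapsTo_arcIoc hxy hbefore)
    omega
  · have hya := cdist_add x y a
    have := cdist_pos y a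
    have : cdist y (u a) < cdist y (u y) := h y (mem_arcIoo.mpr (by omega))
    have := cdist_add x y (u a)
    omega

lemma IsNC.mul_swap (h : IsNC u) (hne : x ≠ y) (hxy : u.SameCycle x y) :
    IsNC (u * swap x y) := by
  intro z
  rcases eq_or_ne z x with rfl | hzx
  · simpa using h.mapsTo_mul_swap_arcIoo hne hxy
  rcases eq_or_ne z y with rfl | hzy
  · simpa [swap_comm z x] using h.mapsTo_mul_swap_arcIoo hne.symm hxy.symm
  rw [mul_swap_apply_of_ne_of_ne hzx hzy]
  intro a ha
  refine h z (mem_of_sameCycle (h z) ?_ ha)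
  exact rel_swap_apply (r := SameCycle.setoid u) hxy a

lemma ArcsStable.sameCycle_apply (h : ArcsStable u p) (hu : IsNC u) (x : Fin n) :
    u.SameCycle x (p x) := by
  by_contra hcon
  obtain ⟨a, ha, hpx⟩ := exists_sameCycle_mem_arcIoo hcon
  have hx : cdist a x < cdist a (u a) :=
    h.mem_arcIoo_of_sameCycle (sameCycle_self_apply p x).symm hpx
  have := hu.cdist_apply_le ha.symm
  omega

lemma ArcsStable.mapsTo_arcIoo_of_apply_eq (h : ArcsStable u p) (hu : IsNC u) (hp : IsNC p)
    (hne : x ≠ y) (hy : u y = p x) (hxy : u.SameCycle x y) :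
    Set.MapsTo p (arcIoo y (u x)) (arcIoo y (u x)) := by
  intro a ha
  rw [mem_arcIoo] at ha ⊢
  have hux := hu.cdist_apply_le hxy
  have huy := hu.cdist_apply_le hxy.symm
  have hround := cdist_add_comm hne
  have hyux := cdist_add y x (u x)
  have hyuy := cdist_add y x (u y)
  have hya := cdist_add y x a
  have hypa := cdist_add y x (p a)
  have hpos := cdist_pos x
  by_cases hmem : a ∈ arcIoo x (p x)
  · rw [← hy, mem_arcIoo] at hmem
    rcases lt_or_ge (cdist x a) (cdist x (u x)) with hxa | hxa
    · have : cdist x (p a) < cdist x (u x) := h x hxa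
      have := hpos (p a)
      omega
    · have : cdist y (p a) < cdist y (u y) := h y (mem_arcIoo.mpr (by have := hpos a; omega))
      have := hpos (u x)
      omega
  · have hpa : p a ∉ arcIoo x (p x) := fun hpa =>
      hmem (mem_of_sameCycle (hp x) (sameCycle_self_apply p a).symm hpa)
    rw [← hy, mem_arcIoo] at hmem hpa
    have := cdist_le x (p a)
    have := cdist_le y (p a)
    have := cdist_pos y (u y)
    have := hpos (u x)
    omega

lemma ArcsStable.mul_swap (h : ArcsStable u p) (hu : IsNC u) (hp : IsNC p) (hne : x ≠ y)
    (hy : u y = p x) (hxy : u.SameCycle x y) : ArcsStable (u * swap x y) p := by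
  intro z
  rcases eq_or_ne z x with rfl | hzx
  · simpa [hy] using hp z
  rcases eq_or_ne z y with rfl | hzy
  · simpa using h.mapsTo_arcIoo_of_apply_eq hu hp hne hy hxy
  · simpa only [mul_swap_apply_of_ne_of_ne hzx hzy] using h z

lemma absLE_of_arcsStable (hp : IsNC p) (hu : IsNC u) (h : ArcsStable u p) :
    AbsLE (swaps (Fin n)) p u := by
  induction hk : reflLength (swaps (Fin n)) u using Nat.strong_induction_on generalizing u with
  | _ k ih =>
    obtain rfl | hpu := eq_or_ne p u
    · exact absLE_refl p
    obtain ⟨x, hx⟩ : ∃ x, p x ≠ u x := by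
      by_contra! heq
      exact hpu (Equiv.ext heq)
    obtain ⟨y, huy⟩ : ∃ y, u y = p x := u.surjective (p x)
    have hne : x ≠ y := by rintro rfl; exact hx huy.symm
    have hxy : u.SameCycle x y :=
      (h.sameCycle_apply hu x).trans (huy ▸ (sameCycle_self_apply u y).symm)
    have hlen := reflLength_mul_swap hne hxy
    exact absLE_of_absLE_mul_swap hne hxy
      (ih _ (by omega) (hu.mul_swap hne hxy) (h.mul_swap hu hp hne huy hxy) rfl)

lemma isNC_of_absLE {v : Perm (Fin n)} (hv : IsNC v) (h : AbsLE (swaps (Fin n)) u v) :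
    IsNC u := by
  refine absLE_downward_induction closure_swaps ?_ h hv
  rintro v _ ⟨x, y, hne, rfl⟩ hlen hNC
  have hxy : (v * swap x y).SameCycle x y :=
    sameCycle_mul_swap_of_not fun hcon => by have := reflLength_mul_swap hne hcon; omega
  simpa using hNC.mul_swap hne hxy

lemma cdist_finRotate (x : Fin n) : cdist x (finRotate n x) = 1 := by
  obtain _ | n := n
  · exact x.elim0
  have hval : (finRotate (n + 1) x : ℕ) = _ := coe_finRotate x
  have := cdist_eq_or x (finRotate (n + 1) x)
  simp only [Fin.ext_iff, Fin.val_last] at hval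
  split_ifs at hval <;> omega

lemma arcsStable_finRotate (p : Perm (Fin n)) : ArcsStable (finRotate n) p := by
  intro x y hy
  have := cdist_pos x y
  rw [mem_arcIoo, cdist_finRotate] at hy
  omega

lemma isNC_finRotate : IsNC (finRotate n) := arcsStable_finRotate _

end NoncrossingPermutations

section NoncrossingPartitions

/-- No two classes of `r` cross: an arc joining two points of a class contains all or none of any
other class. -/
def NonCrossing (r : Setoid (Fin n)) : Prop :=
  ∀ ⦃x z a b⦄, r x z → r a b → a ∈ arcIoo x z → b ∉ arcIoo x z → r x a

lemma IsNC.nonCrossing {u : Perm (Fin n)} (h : IsNC u) : NonCrossing (SameCycle.setoid u) := by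
  intro x z a b hxz hab ha hb
  by_contra hcon
  obtain ⟨e, he, hae⟩ := exists_sameCycle_mem_arcIoo hcon
  have hbe : b ∈ arcIoo e (u e) := ArcsStable.mem_arcIoo_of_sameCycle h hab hae
  have hx := h.cdist_apply_le he.symm
  have hz := h.cdist_apply_le (he.symm.trans hxz)
  rw [mem_arcIoo] at ha hb hae hbe
  have := cdist_add x e a
  have := cdist_add x e b
  have := cdist_add x e z
  have hround := cdist_add x e x
  have := cdist_le x b
  have := cdist_pos e a
  have := cdist_pos e b
  have := cdist_pos e z
  rw [cdist_self] at hround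
  omega

/-- The first point after `x` in its class. -/
noncomputable def next (r : Setoid (Fin n)) (x : Fin n) : Fin n :=
  Function.argminOn (cdist x) {y | r x y} ⟨x, r.refl x⟩

lemma rel_next (r : Setoid (Fin n)) (x : Fin n) : r x (next r x) :=
  Function.argminOn_mem (cdist x) {y | r x y} _

lemma cdist_next_le {r : Setoid (Fin n)} {x y : Fin n} (h : r x y) :
    cdist x (next r x) ≤ cdist x y :=
  Function.argminOn_le (cdist x) {y | r x y} h

lemma next_injective (r : Setoid (Fin n)) : Function.Injective (next r) := by
  intro x y h
  by_contra hne
  have hxy : r x y := r.trans (rel_next r x) (h ▸ r.symm (rel_next r y))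
  have hx := cdist_next_le hxy
  have hy := cdist_next_le (r.symm hxy)
  rw [← h] at hy
  have := cdist_add x y (next r x)
  have := cdist_add_comm hne
  have := cdist_pos x (next r x)
  have := cdist_pos y (next r x)
  omega

/-- The permutation whose cycles are the classes of `r`, each traversed once forward around the
circle. -/
noncomputable def nextPerm (r : Setoid (Fin n)) : Perm (Fin n) :=
  Equiv.ofBijective (next r) (Finite.injective_iff_bijective.mp (next_injective r))

lemma nextPerm_sameCycle_iff {r : Setoid (Fin n)} {x y : Fin n} :
    (nextPerm r).SameCycle x y ↔ r x y := by
  refine ⟨rel_of_sameCycle (rel_next r), fun h => ?_⟩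
  by_contra hcon
  obtain ⟨a, ha, hy⟩ := exists_sameCycle_mem_arcIoo hcon
  have hay : r a y := r.trans (r.symm (rel_of_sameCycle (rel_next r) ha)) h
  exact absurd (cdist_next_le hay) (not_le.mpr hy)

lemma isNC_nextPerm {r : Setoid (Fin n)} (h : NonCrossing r) : IsNC (nextPerm r) := by
  intro x a ha
  by_contra hcon
  have hxa : r x a := h (rel_next r x) (rel_next r a) ha hcon
  exact absurd (cdist_next_le hxa) (not_le.mpr ha)

/-- The partition whose only class with more than one element is `A`. -/
def blockSetoid (A : Set (Fin n)) : Setoid (Fin n) where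
  r x y := x = y ∨ (x ∈ A ∧ y ∈ A)
  iseqv := ⟨fun _ => Or.inl rfl, by grind, by grind⟩

lemma blockSetoid_iff {A : Set (Fin n)} {x y : Fin n} :
    blockSetoid A x y ↔ x = y ∨ (x ∈ A ∧ y ∈ A) := Iff.rfl

lemma nonCrossing_blockSetoid (A : Set (Fin n)) : NonCrossing (blockSetoid A) := by
  intro x z a b hxz hab ha hb
  obtain rfl | ⟨haA, hbA⟩ := hab
  · exact absurd ha hb
  obtain rfl | ⟨hxA, -⟩ := hxz
  · rw [mem_arcIoo, cdist_self, not_lt] at hb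
    obtain rfl : b = x :=
      cdist_right_injective x (le_antisymm (by simpa using cdist_le x b) (by simpa using hb))
    exact Or.inr ⟨hbA, haA⟩
  · exact Or.inr ⟨hxA, haA⟩

lemma nonCrossing_ker_mem_arcIoc (p q : Fin n) : NonCrossing (Setoid.ker (· ∈ arcIoc p q)) := by
  intro x z a b hxz hab ha hb
  simp only [Setoid.ker_def, mem_arcIoc, mem_arcIoo, eq_iff_iff] at *
  have := cdist_add p x a
  have := cdist_add p x b
  have := cdist_add p x z
  have := cdist_le p b
  have := cdist_le p z
  have := cdist_pos p z
  have := cdist_pos p a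
  have := cdist_pos x b
  have := cdist_pos x a
  omega

end NoncrossingPartitions

section NoncrossingProjection

/-- The finest noncrossing partition coarser than the partition into cycles of `w`. -/
def ncClosure (w : Perm (Fin n)) : Setoid (Fin n) :=
  sInf {r | NonCrossing r ∧ ∀ x, r x (w x)}

variable {w : Perm (Fin n)} {x y : Fin n}

lemma ncClosure_le {r : Setoid (Fin n)} (hr : NonCrossing r) (hw : ∀ x, r x (w x)) :
    ncClosure w ≤ r :=
  sInf_le ⟨hr, hw⟩

lemma ncClosure_apply (w : Perm (Fin n)) (x : Fin n) : ncClosure w x (w x) :=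
  fun _ hr => hr.2 x

lemma nonCrossing_ncClosure (w : Perm (Fin n)) : NonCrossing (ncClosure w) :=
  fun _ _ _ _ hxz hab ha hb r hr => hr.1 (hxz r hr) (hab r hr) ha hb

lemma isNCJoin_nextPerm_ncClosure (w : Perm (Fin n)) :
    IsNCJoin (swaps (Fin n)) (finRotate n) {t | t ∈ swaps (Fin n) ∧ AbsLE (swaps (Fin n)) t w}
      (nextPerm (ncClosure w)) := by
  have hNC : IsNC (nextPerm (ncClosure w)) := isNC_nextPerm (nonCrossing_ncClosure w)
  refine ⟨⟨absLE_one_left _, absLE_of_arcsStable hNC isNC_finRotate (arcsStable_finRotate _)⟩,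
    ?_, ?_⟩
  · rintro _ ⟨⟨x, y, hne, rfl⟩, hxy⟩
    rw [absLE_swap_iff hne] at hxy ⊢
    exact nextPerm_sameCycle_iff.mpr (rel_of_sameCycle (ncClosure_apply w) hxy)
  · rintro u ⟨-, hu⟩ hle
    have huNC : IsNC u := isNC_of_absLE isNC_finRotate hu
    have huw : ∀ z, u.SameCycle z (w z) := fun z => by
      rcases eq_or_ne z (w z) with hz | hz
      · rw [← hz]
      · rw [← absLE_swap_iff hz]
        exact hle _ ⟨swap_mem_swaps hz, (absLE_swap_iff hz).mpr (sameCycle_self_apply w z)⟩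
    refine absLE_of_arcsStable hNC huNC fun x y hy => ?_
    exact ArcsStable.mem_arcIoo_of_sameCycle huNC
      (ncClosure_le huNC.nonCrossing huw (rel_next (ncClosure w) y)) hy

lemma ncProjA_eq (w : Perm (Fin n)) : ncProjA w = nextPerm (ncClosure w) := by
  have hjoin := isNCJoin_nextPerm_ncClosure w
  have hex : ∃ v, IsNCJoin (transpositions n) (finRotate n)
      {t | t ∈ transpositions n ∧ AbsLE (transpositions n) t w} v := ⟨_, hjoin⟩
  rw [ncProjA, ncProj, dif_pos hex]
  exact isNCJoin_unique closure_swaps hex.choose_spec hjoin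

lemma isNC_ncProjA (w : Perm (Fin n)) : IsNC (ncProjA w) :=
  ncProjA_eq w ▸ isNC_nextPerm (nonCrossing_ncClosure w)

lemma sameCycle_ncProjA (w : Perm (Fin n)) (x : Fin n) : (ncProjA w).SameCycle x (w x) := by
  rw [ncProjA_eq, nextPerm_sameCycle_iff]
  exact ncClosure_apply w x

lemma rel_of_sameCycle_ncProjA {r : Setoid (Fin n)} (hr : NonCrossing r)
    (hw : ∀ x, r x (w x)) (h : (ncProjA w).SameCycle x y) : r x y := by
  rw [ncProjA_eq, nextPerm_sameCycle_iff] at h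
  exact ncClosure_le hr hw h

lemma ncProjA_apply_eq_iff : ncProjA w x = x ↔ w x = x := by
  constructor
  · intro h
    obtain ⟨k, hk⟩ := sameCycle_ncProjA w x
    rw [← hk, zpow_apply_eq_self_of_apply_eq_self h]
  · intro h
    have hrel : ∀ z, blockSetoid {x}ᶜ z (w z) := fun z => by
      rcases eq_or_ne z x with rfl | hz
      · exact Or.inl h.symm
      · exact Or.inr ⟨hz, fun hwz => hz (w.injective (hwz.trans h.symm))⟩
    exact ((rel_of_sameCycle_ncProjA (nonCrossing_blockSetoid _) hrel
      (sameCycle_self_apply _ x)).resolve_right fun hx => hx.1 rfl).symm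

-- Going forward from `x` to `w x` one passes through `ncProjA w x`.
lemma cdist_ncProjA_add (w : Perm (Fin n)) (x : Fin n) :
    cdist (w x) (ncProjA w x) + cdist (ncProjA w x) x = cdist (w x) x + n := by
  have hle := (isNC_ncProjA w).cdist_apply_le (sameCycle_ncProjA w x)
  rcases eq_or_ne (w x) x with hwx | hwx
  · rw [hwx, ncProjA_apply_eq_iff.mpr hwx, cdist_self]
  · have := cdist_add_comm hwx
    have := cdist_add_comm (mt ncProjA_apply_eq_iff.mp hwx)
    have := cdist_add x (w x) (ncProjA w x)
    have := cdist_pos (w x) (ncProjA w x)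
    have := cdist_le (w x) (ncProjA w x)
    omega

lemma ncProjA_eq_one_iff : ncProjA w = 1 ↔ w = 1 := by
  simp only [Equiv.ext_iff, one_apply, ncProjA_apply_eq_iff]

lemma popTA_eq (w : Perm (Fin n)) : popTA w = w * (ncProjA w)⁻¹ := rfl

lemma inv_popTA (w : Perm (Fin n)) : (popTA w)⁻¹ = ncProjA w * w⁻¹ := by
  rw [popTA_eq, mul_inv_rev, inv_inv]

end NoncrossingProjection

section Antiexceedances

lemma aexc_eq_card (u : Perm (Fin n)) : aexc u = (Finset.univ.filter fun y => u y < y).card :=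
  (Finset.card_equiv u fun y => by simp).symm

lemma sum_cdist_apply_add (u : Perm (Fin n)) :
    ∑ y, cdist (u y) y + n * aexc u = n * n := by
  have hpoint : ∀ y, cdist (u y) y + n * (if u y < y then 1 else 0) + (u y).val = y.val + n := by
    intro y
    have := cdist_eq_or (u y) y
    split_ifs with h
    · have := Fin.lt_def.mp h
      omega
    · have := Fin.le_def.mp (not_lt.mp h)
      omega
  have hsum := Finset.sum_congr rfl fun y (_ : y ∈ Finset.univ) => hpoint y
  rw [Finset.sum_add_distrib, Finset.sum_add_distrib, Finset.sum_add_distrib, ← Finset.mul_sum,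
    Finset.sum_boole, Equiv.sum_comp u (fun y : Fin n => y.val)] at hsum
  simp only [Finset.sum_const, Finset.card_univ, Fintype.card_fin, smul_eq_mul, Nat.cast_id,
    ← aexc_eq_card] at hsum
  omega

-- The arcs from `x` to `u x` wind `aexc u` times around the circle.
lemma card_covering_eq_aexc (u : Perm (Fin n)) (z : Fin n) :
    (Finset.univ.filter fun x => u x ≠ x ∧ (x = z ∨ cdist x z < cdist x (u x))).card = aexc u := by
  have hpoint : ∀ x, (if u x ≠ x ∧ (x = z ∨ cdist x z < cdist x (u x)) then 1 else 0) +
      (if u x ≤ z then 1 else 0) = (if u x < x then 1 else 0) + if x ≤ z then 1 else 0 := by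
    intro x
    have := cdist_eq_or x z
    have := cdist_eq_or x (u x)
    simp only [Fin.lt_def, Fin.le_def, Fin.ext_iff]
    split_ifs <;> omega
  have hsum := Finset.sum_congr rfl fun x (_ : x ∈ Finset.univ) => hpoint x
  rw [Finset.sum_add_distrib, Finset.sum_add_distrib,
    Equiv.sum_comp u (fun x => if x ≤ z then 1 else 0)] at hsum
  simpa only [Finset.sum_boole, Nat.cast_id, ← aexc_eq_card] using Nat.add_right_cancel hsum

lemma aexc_eq_zero_iff {u : Perm (Fin n)} : aexc u = 0 ↔ u = 1 := by
  refine ⟨fun h => Equiv.ext fun z => ?_, fun h => by simp [h, aexc]⟩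
  by_contra hz
  rw [← card_covering_eq_aexc u z, Finset.card_eq_zero] at h
  exact Finset.filter_eq_empty_iff.mp h (Finset.mem_univ z) ⟨hz, Or.inl rfl⟩

/-- A cycle that runs forward once around the circle through the points of its support. -/
structure IsIncreasingCycle (u : Perm (Fin n)) : Prop where
  ne_one : u ≠ 1
  cdist_apply_le : ∀ ⦃x z⦄, x ∈ u.support → z ∈ u.support → cdist x (u x) ≤ cdist x z

lemma IsIncreasingCycle.isCycle {u : Perm (Fin n)} (hu : IsIncreasingCycle u) : u.IsCycle := by
  obtain ⟨x, hx⟩ := Finset.nonempty_iff_ne_empty.mpr (mt support_eq_empty_iff.mp hu.ne_one)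
  refine ⟨x, mem_support.mp hx, fun z hz => ?_⟩
  by_contra hxz
  obtain ⟨a, hxa, hza⟩ := exists_sameCycle_mem_arcIoo hxz
  have ha : a ∈ u.support := mem_support.mpr (mt hxa.apply_eq_self_iff.mpr (mem_support.mp hx))
  exact (hu.cdist_apply_le ha (mem_support.mpr hz)).not_gt hza

lemma isIncreasingCycle_iff_aexc {u : Perm (Fin n)} : IsIncreasingCycle u ↔ aexc u = 1 := by
  constructor
  · intro hu
    obtain ⟨z, hz⟩ := Finset.nonempty_iff_ne_empty.mpr (mt support_eq_empty_iff.mp hu.ne_one)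
    rw [← card_covering_eq_aexc u z, Finset.card_eq_one]
    refine ⟨z, Finset.ext fun x => ?_⟩
    simp only [Finset.mem_filter, Finset.mem_univ, true_and, Finset.mem_singleton]
    refine ⟨fun ⟨hx, hxz⟩ => hxz.resolve_right fun hz' => ?_, ?_⟩
    · exact (hu.cdist_apply_le (mem_support.mpr hx) hz).not_gt hz'
    · rintro rfl
      exact ⟨mem_support.mp hz, Or.inl rfl⟩
  · intro h
    refine ⟨fun hu => by simp [aexc_eq_zero_iff.mpr hu] at h, fun x z hx hz => ?_⟩
    by_contra! hlt
    have hcard := (card_covering_eq_aexc u z).trans h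
    obtain rfl : x = z := Finset.card_le_one.mp hcard.le x (by simp_all) z (by simp_all)
    exact (cdist_le x (u x)).not_gt (by simpa using hlt)

lemma IsNC.cyc_eq_one_iff {u : Perm (Fin n)} (hu : IsNC u) : cyc u = 1 ↔ aexc u = 1 := by
  have hcyc : cyc u = 1 ↔ u.IsCycle := by
    rw [← card_cycleType_eq_one, cycleType_def, Multiset.card_map]
    rfl
  rw [hcyc, ← isIncreasingCycle_iff_aexc]
  refine ⟨fun hc => ⟨hc.ne_one, fun x z hx hz => ?_⟩, IsIncreasingCycle.isCycle⟩
  exact hu.cdist_apply_le (hc.sameCycle (mem_support.mp hx) (mem_support.mp hz))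

lemma aexc_popTA_add_aexc_ncProjA (w : Perm (Fin n)) :
    aexc (popTA w) + aexc (ncProjA w) = aexc w := by
  rcases n.eq_zero_or_pos with rfl | hn
  · simp [aexc]
  have hpop : ∑ y, cdist (popTA w y) y = ∑ y, cdist (w y) (ncProjA w y) := by
    rw [← Equiv.sum_comp (ncProjA w)]
    simp [popTA_eq]
  have hsum := Finset.sum_congr rfl fun y (_ : y ∈ Finset.univ) => cdist_ncProjA_add w y
  simp only [Finset.sum_add_distrib, ← hpop, Finset.sum_const, Finset.card_univ,
    Fintype.card_fin, smul_eq_mul] at hsum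
  have := sum_cdist_apply_add w
  have := sum_cdist_apply_add (ncProjA w)
  have := sum_cdist_apply_add (popTA w)
  refine Nat.eq_of_mul_eq_mul_left hn ?_
  rw [mul_add]
  omega

lemma popTA_eq_self_iff {w : Perm (Fin n)} : popTA w = w ↔ w = 1 := by
  rw [popTA_eq, mul_eq_left, inv_eq_one, ncProjA_eq_one_iff]

/-- The permutation `s` with `w⁻¹ = c * s` for the long cycle `c = finRotate n`, a variant of the
Kreweras complement of `w`. -/
def cofactor (w : Perm (Fin n)) : Perm (Fin n) := (w * finRotate n)⁻¹

lemma inv_eq_finRotate_mul_cofactor (w : Perm (Fin n)) : w⁻¹ = finRotate n * cofactor w := by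
  rw [cofactor, mul_inv_rev, mul_inv_cancel_left]

lemma aexc_add_aexc_cofactor (hn : 0 < n) (w : Perm (Fin n)) :
    aexc w + aexc (cofactor w) + 1 = n := by
  have hpoint : ∀ y, cdist (cofactor w y) y + cdist y (w⁻¹ y) = n + 1 := by
    intro y
    rw [inv_eq_finRotate_mul_cofactor, mul_apply]
    have := cdist_add (cofactor w y) y (finRotate n (cofactor w y))
    have := cdist_finRotate (cofactor w y)
    have := cdist_pos (cofactor w y) y
    omega
  have hw : ∑ y, cdist (w y) y = ∑ y, cdist y (w⁻¹ y) := by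
    rw [← Equiv.sum_comp w⁻¹]
    simp
  have hsum := Finset.sum_congr rfl fun y (_ : y ∈ Finset.univ) => hpoint y
  simp only [Finset.sum_add_distrib, ← hw, Finset.sum_const, Finset.card_univ,
    Fintype.card_fin, smul_eq_mul] at hsum
  have := sum_cdist_apply_add w
  have := sum_cdist_apply_add (cofactor w)
  refine Nat.eq_of_mul_eq_mul_left hn ?_
  rw [mul_add, mul_add]
  omega

end Antiexceedances

section Orbits

variable {X : Type*} {f : X → X} {μ : X → ℕ}

lemma forwardOrbit_eq_insert (f : X → X) (x : X) :
    forwardOrbit f x = insert x (forwardOrbit f (f x)) := by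
  ext y
  simp only [forwardOrbit, Set.mem_range, Set.mem_insert_iff]
  constructor
  · rintro ⟨k | k, rfl⟩
    · exact Or.inl rfl
    · exact Or.inr ⟨k, rfl⟩
  · rintro (rfl | ⟨k, rfl⟩)
    · exact ⟨0, rfl⟩
    · exact ⟨k + 1, rfl⟩

lemma forwardOrbit_of_apply_eq {x : X} (hx : f x = x) : forwardOrbit f x = {x} := by
  simp [forwardOrbit, Function.iterate_fixed hx, Set.range_const]

lemma le_of_mem_forwardOrbit (hμ : ∀ x, f x ≠ x → μ (f x) < μ x) {x y : X}
    (hy : y ∈ forwardOrbit f x) : μ y ≤ μ x := by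
  have hle : ∀ z, μ (f z) ≤ μ z := fun z => by
    by_cases hz : f z = z
    · rw [hz]
    · exact (hμ z hz).le
  obtain ⟨k, rfl⟩ := hy
  exact antitone_nat_of_succ_le (f := fun k => μ (f^[k] x))
    (fun k => by simpa only [Function.iterate_succ_apply'] using hle _) k.zero_le

lemma finite_forwardOrbit (hμ : ∀ x, f x ≠ x → μ (f x) < μ x) (x : X) :
    (forwardOrbit f x).Finite := by
  induction hk : μ x using Nat.strong_induction_on generalizing x with
  | _ k ih =>
    by_cases hx : f x = x
    · simp [forwardOrbit_of_apply_eq hx]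
    · rw [forwardOrbit_eq_insert]
      exact (ih _ (hk ▸ hμ x hx) (f x) rfl).insert x

lemma ncard_forwardOrbit_of_apply_ne (hμ : ∀ x, f x ≠ x → μ (f x) < μ x) {x : X} (hx : f x ≠ x) :
    (forwardOrbit f x).ncard = (forwardOrbit f (f x)).ncard + 1 := by
  have hnotMem : x ∉ forwardOrbit f (f x) := fun h =>
    (hμ x hx).not_ge (le_of_mem_forwardOrbit hμ h)
  rw [forwardOrbit_eq_insert, Set.ncard_insert_of_notMem hnotMem (finite_forwardOrbit hμ _)]

lemma ncard_forwardOrbit_le (hμ : ∀ x, f x ≠ x → μ (f x) < μ x) (x : X) :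
    (forwardOrbit f x).ncard ≤ μ x + 1 := by
  induction hk : μ x using Nat.strong_induction_on generalizing x with
  | _ k ih =>
    by_cases hx : f x = x
    · simp [forwardOrbit_of_apply_eq hx]
    · have := hμ x hx
      have := ih _ (by omega) (f x) rfl
      rw [ncard_forwardOrbit_of_apply_ne hμ hx]
      omega

lemma ncard_forwardOrbit_eq (hμ : ∀ x, f x ≠ x → μ (f x) < μ x) {P : X → Prop}
    (hfix : ∀ x, P x → f x = x → μ x = 0)
    (hstep : ∀ x, P x → f x ≠ x → P (f x) ∧ μ (f x) + 1 = μ x) {x : X} (hx : P x) :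
    (forwardOrbit f x).ncard = μ x + 1 := by
  induction hk : μ x using Nat.strong_induction_on generalizing x with
  | _ k ih =>
    by_cases hfx : f x = x
    · have := hfix x hx hfx
      simp [forwardOrbit_of_apply_eq hfx, ← hk, this]
    · obtain ⟨hPfx, hμx⟩ := hstep x hx hfx
      rw [ncard_forwardOrbit_of_apply_ne hμ hfx, ih _ (by omega) hPfx rfl]
      omega

end Orbits

section PopOrbits

variable {w : Perm (Fin n)}

lemma aexc_popTA_lt (hw : popTA w ≠ w) : aexc (popTA w) < aexc w := by
  have hpos : aexc (ncProjA w) ≠ 0 := by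
    rwa [Ne, aexc_eq_zero_iff, ncProjA_eq_one_iff, ← popTA_eq_self_iff]
  have := aexc_popTA_add_aexc_ncProjA w
  omega

lemma ncard_forwardOrbit_popTA_le (w : Perm (Fin n)) :
    (forwardOrbit popTA w).ncard ≤ aexc w + 1 :=
  ncard_forwardOrbit_le (fun _ => aexc_popTA_lt) w

lemma ncard_forwardOrbit_popTA_eq {P : Perm (Fin n) → Prop}
    (hP : ∀ w, P w → w ≠ 1 → P (popTA w) ∧ aexc (ncProjA w) = 1) (hw : P w) :
    (forwardOrbit popTA w).ncard = aexc w + 1 := by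
  refine ncard_forwardOrbit_eq (fun _ => aexc_popTA_lt)
    (fun w _ hfix => aexc_eq_zero_iff.mpr (popTA_eq_self_iff.mp hfix)) (fun w hw hpop => ?_) hw
  obtain ⟨hPpop, haexc⟩ := hP w hw (mt popTA_eq_self_iff.mpr hpop)
  exact ⟨hPpop, haexc ▸ aexc_popTA_add_aexc_ncProjA w⟩

end PopOrbits

section Inversions

/-- An inversion of the lift of `g` to the universal cover of the circle that moves every point
forward by at most one turn: the point in front of `x` at distance `cdist x y` is not mapped in
front of the image of `x`. -/
def IsInversion (g : Perm (Fin n)) (x y : Fin n) : Prop :=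
  cdist x y + cdist y (g y) ≤ cdist x (g x)

/-- The inversions of `g` start at points of `S` and end before the next point of `S`, and `S` does
not consist of two points moved by `g`. -/
structure ConfinesInversions (S : Set (Fin n)) (g : Perm (Fin n)) : Prop where
  start_mem : ∀ ⦃x y⦄, IsInversion g x y → x ∈ S
  cdist_lt : ∀ ⦃x y t⦄, IsInversion g x y → t ∈ S → cdist x y < cdist x t
  exists_third : ∀ ⦃b b'⦄, b ∈ S → b' ∈ S → b ≠ b' → g b ≠ b → g b' ≠ b' →
    ∃ t ∈ S, t ≠ b ∧ t ≠ b'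

variable {g : Perm (Fin n)} {S : Set (Fin n)} {p q : Fin n}

lemma compl_arcIoc (hpq : p ≠ q) : (arcIoc p q)ᶜ = arcIoc q p := by
  ext z
  have := cdist_add p q z
  have := cdist_add_comm hpq
  have := cdist_pos q z
  have := cdist_pos p z
  have := cdist_le p z
  rw [Set.mem_compl_iff, mem_arcIoc, mem_arcIoc]
  omega

lemma exists_arcIoc_eq_arcIoo {x y z : Fin n} (hz : z ∈ arcIoo x y) :
    ∃ q, arcIoc x q = arcIoo x y := by
  refine ⟨(finRotate n).symm y, Set.ext fun a => ?_⟩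
  have hq := cdist_finRotate ((finRotate n).symm y)
  rw [apply_symm_apply] at hq
  rw [mem_arcIoo] at hz
  rw [mem_arcIoc, mem_arcIoo]
  have := cdist_add x ((finRotate n).symm y) y
  have := cdist_le x ((finRotate n).symm y)
  have := cdist_pos x z
  omega

/-- A point moved backward on a stable arc can only stay on it by running past the complementary
arc, where it meets every point moved forward. -/
lemma isInversion_of_mem_arcIoc {b y : Fin n} (hpq : p ≠ q) (hb : b ∈ arcIoc p q)
    (hgb : cdist p (g b) ≤ cdist p b) (hgy : g y ∈ arcIoc q p)
    (hy : cdist q y < cdist q (g y)) : IsInversion g b y := by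
  rw [mem_arcIoc] at hb hgy
  rw [IsInversion]
  have := cdist_add_comm hpq
  have := cdist_add p b y
  have := cdist_add p q y
  have := cdist_add p q (g y)
  have := cdist_add q y (g y)
  have := cdist_add p b (g b)
  have := cdist_pos p (g b)
  have := cdist_le p (g y)
  have := cdist_le p y
  have := cdist_pos q y
  have := cdist_pos q (g y)
  have := cdist_pos y (g y)
  omega

lemma cdist_lt_cdist_of_mem_arcIoc {s t y : Fin n} (hpq : p ≠ q) (ht : t ∈ arcIoc q p)
    (hst : cdist q s < cdist q t) (hy : y ∈ arcIoc p q) : cdist s t < cdist s y := by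
  rw [← compl_arcIoc hpq.symm, Set.mem_compl_iff] at hy
  rw [mem_arcIoc] at ht hy
  have := cdist_add q s t
  have := cdist_add q s y
  have := cdist_le q y
  have := cdist_pos s y
  omega

lemma exists_apply_lt_of_mapsTo {α β : Type*} [Finite α] [LinearOrder β] {φ : α → β}
    (hφ : Function.Injective φ) {g : Perm α} {A : Set α} (hA : Set.MapsTo g A A) {z : α}
    (hz : z ∈ A) (hgz : g z ≠ z) : ∃ b ∈ A, φ (g b) < φ b := by
  obtain ⟨b, ⟨hb, hgb⟩, hmax⟩ :=
    Set.exists_max_image {z | z ∈ A ∧ g z ≠ z} φ (Set.toFinite _) ⟨z, hz, hgz⟩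
  exact ⟨b, hb, (hmax (g b) ⟨hA hb, g.injective.ne hgb⟩).lt_of_ne (hφ.ne hgb)⟩

lemma exists_moved_backward (hA : Set.MapsTo g (arcIoc p q) (arcIoc p q)) {z : Fin n}
    (hz : z ∈ arcIoc p q) (hgz : g z ≠ z) : ∃ b ∈ arcIoc p q, cdist p (g b) < cdist p b :=
  exists_apply_lt_of_mapsTo (cdist_right_injective p) hA hz hgz

lemma exists_moved_forward (hA : Set.MapsTo g (arcIoc p q) (arcIoc p q)) {z : Fin n}
    (hz : z ∈ arcIoc p q) (hgz : g z ≠ z) : ∃ y ∈ arcIoc p q, cdist p y < cdist p (g y) :=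
  exists_apply_lt_of_mapsTo (φ := OrderDual.toDual ∘ cdist p)
    (OrderDual.toDual.injective.comp (cdist_right_injective p)) hA hz hgz

lemma ConfinesInversions.eq_of_mem_arcIoc (h : ConfinesInversions S g) (hpq : p ≠ q)
    (hJ : Set.MapsTo g (arcIoc q p) (arcIoc q p)) {b y' b' t : Fin n}
    (hb : b ∈ arcIoc p q) (hgb : cdist p (g b) < cdist p b)
    (hy' : y' ∈ arcIoc p q) (hgy' : g y' ∈ arcIoc p q) (hlt : cdist p y' < cdist p (g y'))
    (hb' : b' ∈ arcIoc q p) (hgb' : cdist q (g b') < cdist q b')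
    (ht : t ∈ S) (htJ : t ∈ arcIoc q p) : t = b' := by
  have hb'y' : IsInversion g b' y' := isInversion_of_mem_arcIoc hpq.symm hb' hgb'.le hgy' hlt
  by_contra hne
  have htb' : cdist q t < cdist q b' := by
    refine ((cdist_right_injective q).ne hne).lt_or_gt.resolve_right fun hb't => ?_
    exact (h.cdist_lt hb'y' ht).not_gt (cdist_lt_cdist_of_mem_arcIoc hpq htJ hb't hy')
  have hgt : cdist q (g t) ≤ cdist q t := by
    by_contra! hlt
    exact (h.cdist_lt (isInversion_of_mem_arcIoc hpq hb hgb.le (hJ htJ) hlt) ht).false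
  have hty' : IsInversion g t y' := isInversion_of_mem_arcIoc hpq.symm htJ hgt hgy' hlt
  exact (h.cdist_lt hty' (h.start_mem hb'y')).not_gt
    (cdist_lt_cdist_of_mem_arcIoc hpq hb' htb' hy')

lemma ConfinesInversions.apply_eq_of_mapsTo (h : ConfinesInversions S g)
    (hI : Set.MapsTo g (arcIoc p q) (arcIoc p q)) {i j : Fin n} (hi : i ∈ arcIoc p q)
    (hgi : g i ≠ i) (hj : j ∉ arcIoc p q) : g j = j := by
  by_contra hgj
  have hpq : p ≠ q := by
    rintro rfl
    exact hj (by simpa [mem_arcIoc] using cdist_le p j)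
  have hcompl := compl_arcIoc hpq
  have hJ : Set.MapsTo g (arcIoc q p) (arcIoc q p) := by
    rw [← hcompl]
    exact fun z hz hgz => hz (mem_of_sameCycle hI (sameCycle_self_apply g z).symm hgz)
  rw [← Set.mem_compl_iff, hcompl] at hj
  obtain ⟨b, hb, hgb⟩ := exists_moved_backward hI hi hgi
  obtain ⟨y', hy', hgy'⟩ := exists_moved_forward hI hi hgi
  obtain ⟨b', hb', hgb'⟩ := exists_moved_backward hJ hj hgj
  obtain ⟨y, hy, hgy⟩ := exists_moved_forward hJ hj hgj
  have hbS : b ∈ S := h.start_mem (isInversion_of_mem_arcIoc hpq hb hgb.le (hJ hy) hgy)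
  have hb'S : b' ∈ S :=
    h.start_mem (isInversion_of_mem_arcIoc hpq.symm hb' hgb'.le (hI hy') hgy')
  have hne : b ≠ b' := by
    rintro rfl
    rw [← hcompl] at hb'
    exact hb' hb
  obtain ⟨t, ht, htb, htb'⟩ := h.exists_third hbS hb'S hne
    (ne_of_apply_ne (cdist p) hgb.ne) (ne_of_apply_ne (cdist q) hgb'.ne)
  by_cases htI : t ∈ arcIoc p q
  · exact htb (h.eq_of_mem_arcIoc hpq.symm hI hb' hgb' hy (hJ hy) hgy hb hgb ht htI)
  · rw [← Set.mem_compl_iff, hcompl] at htI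
    exact htb' (h.eq_of_mem_arcIoc hpq hJ hb hgb hy' (hI hy') hgy' hb' hgb' ht htI)

variable {w : Perm (Fin n)}

lemma ConfinesInversions.isIncreasingCycle_ncProjA (h : ConfinesInversions S w⁻¹) (hw : w ≠ 1) :
    IsIncreasingCycle (ncProjA w) := by
  refine ⟨mt ncProjA_eq_one_iff.mp hw, fun x z hx hz => ?_⟩
  by_contra! hlt
  obtain ⟨q, hq⟩ := exists_arcIoc_eq_arcIoo (mem_arcIoo.mpr hlt)
  have hstable : Set.MapsTo ⇑w⁻¹ (arcIoc x q) (arcIoc x q) := by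
    rw [hq]
    refine fun a ha => ArcsStable.mem_arcIoo_of_sameCycle (isNC_ncProjA w) ?_ ha
    simpa using (sameCycle_ncProjA w (w⁻¹ a)).symm
  have hmoved : ∀ a, a ∈ (ncProjA w).support → w⁻¹ a ≠ a := fun a ha => by
    rw [← mem_support, support_inv]
    exact mem_support.mpr (mt ncProjA_apply_eq_iff.mpr (mem_support.mp ha))
  refine hmoved x hx (h.apply_eq_of_mapsTo hstable (hq ▸ mem_arcIoo.mpr hlt) (hmoved z hz) ?_)
  rw [hq, mem_arcIoo, cdist_self, not_lt]
  exact cdist_le x _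

lemma IsIncreasingCycle.isInversion_of_popTA (h : IsIncreasingCycle (ncProjA w)) {x y : Fin n}
    (hxy : IsInversion (popTA w)⁻¹ x y) : IsInversion w⁻¹ x y := by
  obtain ⟨x, rfl⟩ := w.surjective x
  obtain ⟨y, rfl⟩ := w.surjective y
  simp only [IsInversion, inv_popTA, mul_apply, coe_inv, symm_apply_apply] at hxy ⊢
  have hx := cdist_ncProjA_add w x
  have hy := cdist_ncProjA_add w y
  have := cdist_pos (w x) y
  have := cdist_le (w x) (ncProjA w x)
  by_cases hyπ : ncProjA w y = y
  · rw [hyπ, ncProjA_apply_eq_iff.mp hyπ, cdist_self] at hxy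
    omega
  by_cases hxπ : ncProjA w x = x
  · rw [hxπ] at hxy
    have := cdist_le (ncProjA w y) y
    omega
  have hxy' := h.cdist_apply_le (mem_support.mpr hxπ) (mem_support.mpr hyπ)
  have := cdist_add_comm hxπ
  have := cdist_add_comm hyπ
  have := cdist_add (w x) (w y) y
  have := cdist_add (w x) x y
  have := cdist_pos y (ncProjA w y)
  omega

lemma ConfinesInversions.popTA_inv (h : ConfinesInversions S w⁻¹) (hw : w ≠ 1) :
    ConfinesInversions S (popTA w)⁻¹ := by
  have hπ := h.isIncreasingCycle_ncProjA hw
  have hmoved : ∀ x, (popTA w)⁻¹ x ≠ x → w⁻¹ x ≠ x := fun x => mt fun hx => by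
    rw [inv_popTA, mul_apply, hx, ncProjA_apply_eq_iff, ← inv_eq_iff_eq.mp hx]
  exact ⟨fun _ _ hxy => h.start_mem (hπ.isInversion_of_popTA hxy),
    fun _ _ _ hxy => h.cdist_lt (hπ.isInversion_of_popTA hxy),
    fun b b' hb hb' hne hgb hgb' => h.exists_third hb hb' hne (hmoved b hgb) (hmoved b' hgb')⟩

lemma ConfinesInversions.ncard_forwardOrbit (h : ConfinesInversions S w⁻¹) :
    (forwardOrbit popTA w).ncard = aexc w + 1 :=
  ncard_forwardOrbit_popTA_eq (P := fun w => ConfinesInversions S w⁻¹)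
    (fun _ h hw => ⟨h.popTA_inv hw,
      isIncreasingCycle_iff_aexc.mp (h.isIncreasingCycle_ncProjA hw)⟩) h

end Inversions

section Splitting

variable {s w : Perm (Fin n)} {S : Finset (Fin n)} {b b' i x y : Fin n}

lemma finRotate_ne_self (hn : 2 ≤ n) (i : Fin n) : finRotate n i ≠ i := by
  intro h
  have := cdist_finRotate i
  rw [h, cdist_self] at this
  omega

/-- The supports of the cofactors of the `A`-splittable permutations. -/
def splittingSets (n : ℕ) : Finset (Finset (Fin n)) :=
  (Finset.univ.filter fun S => 3 ≤ S.card) ∪ Finset.univ.image fun i => {i, finRotate n i}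

lemma mem_splittingSets : S ∈ splittingSets n ↔ 3 ≤ S.card ∨ ∃ i, S = {i, finRotate n i} := by
  simp [splittingSets, eq_comm]

lemma two_le_card_of_mem_splittingSets (hn : 2 ≤ n) (hS : S ∈ splittingSets n) : 2 ≤ S.card := by
  obtain h | ⟨i, rfl⟩ := mem_splittingSets.mp hS
  · omega
  · rw [Finset.card_pair (finRotate_ne_self hn i).symm]

lemma eq_swap_of_support_eq (h : s.support = {x, y}) : s = swap x y := by
  have hcard : s.support.card = 2 := by
    refine le_antisymm (h ▸ Finset.card_le_two) (two_le_card_support_of_ne_one fun hs => ?_)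
    rw [hs, support_one] at h
    exact Finset.insert_ne_empty _ _ h.symm
  obtain ⟨a, b, hab, rfl⟩ := card_support_eq_two.mp hcard
  rw [support_swap hab, ← Finset.coe_inj, Finset.coe_pair, Finset.coe_pair,
    Set.pair_eq_pair_iff] at h
  obtain ⟨rfl, rfl⟩ | ⟨rfl, rfl⟩ := h
  · rfl
  · exact swap_comm a b

lemma isInversion_finRotate_mul
    (hs : ∀ ⦃x z⦄, x ∈ s.support → z ∈ s.support → cdist x (s x) ≤ cdist x z)
    (hxy : IsInversion (finRotate n * s) x y) :
    x ∈ s.support ∧ ∀ t ∈ s.support, cdist x y < cdist x t := by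
  rw [IsInversion, mul_apply, mul_apply] at hxy
  have hcx := cdist_finRotate (s x)
  have := cdist_add x (s x) (finRotate n (s x))
  have := cdist_pos x y
  have := cdist_pos y (finRotate n (s y))
  have hx : s x ≠ x := fun hx => by
    rw [hx] at hxy hcx
    omega
  have := cdist_add_comm hx
  have := cdist_le x (finRotate n (s x))
  refine ⟨mem_support.mpr hx, fun t ht => ?_⟩
  have hxt := hs (mem_support.mpr hx) ht
  suffices hne : cdist x y ≠ cdist x (s x) by omega
  intro heq
  obtain rfl : y = s x := cdist_right_injective x heq
  have := cdist_add (s x) (s (s x)) (finRotate n (s (s x)))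
  have := cdist_finRotate (s (s x))
  have := cdist_add_comm (s.injective.ne hx)
  have := cdist_pos (s x) (s (s x))
  have := cdist_pos (s (s x)) (s x)
  omega

lemma confinesInversions_finRotate : ConfinesInversions (∅ : Set (Fin n)) (finRotate n) := by
  have h : ∀ x y, ¬ IsInversion (finRotate n) x y := fun x y hxy => by
    rw [IsInversion, cdist_finRotate, cdist_finRotate] at hxy
    have := cdist_pos x y
    omega
  exact ⟨fun x y hxy => (h x y hxy).elim, fun _ _ _ _ => False.elim, fun _ _ => False.elim⟩

lemma IsIncreasingCycle.confinesInversions (hs : IsIncreasingCycle s)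
    (hS : s.support ∈ splittingSets n) :
    ConfinesInversions (s.support : Set (Fin n)) (finRotate n * s) := by
  refine ⟨fun x y hxy => (isInversion_finRotate_mul hs.cdist_apply_le hxy).1,
    fun x y t hxy => (isInversion_finRotate_mul hs.cdist_apply_le hxy).2 t,
    fun b b' hb hb' hne hgb hgb' => ?_⟩
  obtain h | ⟨i, hi⟩ := mem_splittingSets.mp hS
  · obtain ⟨t, ht, htb⟩ := Finset.exists_mem_notMem_of_card_lt_card
      ((Finset.card_le_two (a := b) (b := b')).trans_lt h)
    simp only [Finset.mem_insert, Finset.mem_singleton, not_or] at htb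
    exact ⟨t, ht, htb⟩
  · have hfix : (finRotate n * s) (finRotate n i) = finRotate n i := by
      rw [eq_swap_of_support_eq hi, mul_apply, swap_apply_right]
    simp only [hi, Finset.coe_insert, Finset.coe_singleton, Set.mem_insert_iff,
      Set.mem_singleton_iff] at hb hb'
    grind

lemma mapsTo_finRotate_mul_swap (hne : b ≠ b') :
    Set.MapsTo ⇑(finRotate n * swap b b') (arcIoc b b') (arcIoc b b') := by
  intro x hx
  have hbb' := cdist_add_comm hne
  have := cdist_pos b' b
  have hxb : x ≠ b := by
    rintro rfl
    rw [mem_arcIoc, cdist_self] at hx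
    omega
  rw [mem_arcIoc] at *
  rw [mul_apply]
  by_cases hxb' : x = b'
  · rw [hxb', swap_apply_right, cdist_finRotate]
    exact cdist_pos b b'
  · rw [swap_apply_of_ne_of_ne hxb hxb']
    have := (cdist_right_injective b).ne hxb'
    have := cdist_add b x (finRotate n x)
    have := cdist_finRotate x
    omega

lemma apply_mem_of_mapsTo_inv {A : Set (Fin n)} (hA : Set.MapsTo ⇑w⁻¹ A A) :
    w x ∈ A ↔ x ∈ A := by
  have h : w⁻¹.SameCycle (w x) x := by simpa using sameCycle_self_apply w⁻¹ (w x)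
  exact ⟨mem_of_sameCycle hA h, mem_of_sameCycle hA h.symm⟩

-- Both arcs between `b` and `b'` are stable under `w`, hence under its noncrossing projection.
lemma not_isCycle_ncProjA_of_inv_eq (hw : w⁻¹ = finRotate n * swap b b') (hne : b ≠ b')
    (hb : finRotate n b ≠ b') (hb' : finRotate n b' ≠ b) : ¬ (ncProjA w).IsCycle := by
  intro hcycle
  have hmoved : ∀ {x}, w⁻¹ x ≠ x → ncProjA w x ≠ x := fun {x} hx h =>
    hx (inv_eq_iff_eq.mpr (ncProjA_apply_eq_iff.mp h).symm)
  have hbb' : (ncProjA w).SameCycle b b' :=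
    hcycle.sameCycle (hmoved (by simpa [hw] using hb')) (hmoved (by simpa [hw] using hb))
  have hrel : ∀ x, Setoid.ker (· ∈ arcIoc b b') x (w x) := fun x =>
    propext (apply_mem_of_mapsTo_inv (hw ▸ mapsTo_finRotate_mul_swap hne)).symm
  have hmem : b ∈ arcIoc b b' ↔ b' ∈ arcIoc b b' :=
    (rel_of_sameCycle_ncProjA (nonCrossing_ker_mem_arcIoc b b') hrel hbb').to_iff
  rw [mem_arcIoc, mem_arcIoc, cdist_self] at hmem
  have := cdist_add_comm hne
  have := cdist_pos b' b
  omega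

/-- The cycle through the points of `S`, once forward around the circle. -/
noncomputable def setCycle (S : Finset (Fin n)) : Perm (Fin n) := nextPerm (blockSetoid S)

lemma cdist_setCycle_le (hx : x ∈ S) (hy : y ∈ S) : cdist x (setCycle S x) ≤ cdist x y :=
  cdist_next_le (Or.inr ⟨hx, hy⟩)

lemma support_setCycle (hS : 2 ≤ S.card) : (setCycle S).support = S := by
  ext x
  rw [mem_support]
  refine ⟨fun h => ?_, fun hx h => ?_⟩
  · have hrel : blockSetoid S x (setCycle S x) := rel_next _ x
    exact ((blockSetoid_iff.mp hrel).resolve_left (Ne.symm h)).1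
  · obtain ⟨y, hy, hyx⟩ := S.exists_mem_ne hS x
    have := cdist_setCycle_le hx hy
    rw [h, cdist_self] at this
    have := cdist_add_comm hyx
    have := cdist_pos y x
    omega

lemma isIncreasingCycle_setCycle (hS : 2 ≤ S.card) : IsIncreasingCycle (setCycle S) := by
  refine ⟨?_, ?_⟩
  · rw [Ne, ← support_eq_empty_iff, support_setCycle hS]
    rintro rfl
    simp at hS
  · rw [support_setCycle hS]
    exact fun _ _ => cdist_setCycle_le

lemma IsIncreasingCycle.eq_of_support_eq {u v : Perm (Fin n)} (hu : IsIncreasingCycle u)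
    (hv : IsIncreasingCycle v) (h : u.support = v.support) : u = v := by
  ext1 x
  by_cases hx : x ∈ u.support
  · have hx' : x ∈ v.support := h ▸ hx
    refine cdist_right_injective x (le_antisymm ?_ ?_)
    · exact hu.cdist_apply_le hx (h ▸ apply_mem_support.mpr hx')
    · exact hv.cdist_apply_le hx' (h ▸ apply_mem_support.mpr hx)
  · rw [notMem_support.mp hx, notMem_support.mp (h ▸ hx)]

end Splitting

section Splittable

variable {w : Perm (Fin n)}

lemma aSplittable_iff : ASplittable w ↔ aexc w + 2 = n ∧ aexc (ncProjA w) = 1 := by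
  rw [ASplittable, (isNC_ncProjA w).cyc_eq_one_iff]
  exact and_congr_left fun _ => by omega

lemma support_cofactor_mem_splittingSets (hπ : (ncProjA w).IsCycle)
    (hw : cofactor w ≠ 1) : (cofactor w).support ∈ splittingSets n := by
  rw [mem_splittingSets, or_iff_not_imp_left]
  intro hcard
  obtain ⟨b, b', hne, hS⟩ := Finset.card_eq_two.mp
    (le_antisymm (Nat.lt_succ_iff.mp (not_le.mp hcard)) (two_le_card_support_of_ne_one hw))
  by_contra! hadj
  refine not_isCycle_ncProjA_of_inv_eq ?_ hne (fun h => hadj b (h ▸ hS))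
    (fun h => hadj b' (by rw [h, hS, Finset.pair_comm])) hπ
  rw [← eq_swap_of_support_eq hS, inv_eq_finRotate_mul_cofactor]

lemma aSplittable_iff_cofactor (hn : 3 ≤ n) :
    ASplittable w ↔
      IsIncreasingCycle (cofactor w) ∧ (cofactor w).support ∈ splittingSets n := by
  have haexc := aexc_add_aexc_cofactor (by omega) w
  rw [aSplittable_iff, isIncreasingCycle_iff_aexc]
  refine ⟨fun ⟨_, hπ⟩ => ?_, fun ⟨hs, hS⟩ => ⟨by omega, ?_⟩⟩
  · have hs : aexc (cofactor w) = 1 := by omega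
    exact ⟨hs, support_cofactor_mem_splittingSets
      (isIncreasingCycle_iff_aexc.mpr hπ).isCycle (isIncreasingCycle_iff_aexc.mpr hs).ne_one⟩
  · rw [← isIncreasingCycle_iff_aexc] at hs ⊢
    have hconf := inv_eq_finRotate_mul_cofactor w ▸ hs.confinesInversions hS
    refine hconf.isIncreasingCycle_ncProjA fun h => ?_
    rw [isIncreasingCycle_iff_aexc.mp hs, aexc_eq_zero_iff.mpr h] at haexc
    omega

lemma ncard_forwardOrbit_popTA_eq_sub_one_iff (hn : 3 ≤ n) (w : Perm (Fin n)) :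
    ((forwardOrbit popTA w).ncard : ℤ) = (n : ℤ) - 1 ↔ ASplittable w := by
  have haexc := aexc_add_aexc_cofactor (by omega) w
  constructor
  · intro h
    have hs : aexc (cofactor w) ≠ 0 := fun hs => by
      have hconf : ConfinesInversions ∅ w⁻¹ := by
        rw [inv_eq_finRotate_mul_cofactor, aexc_eq_zero_iff.mp hs, mul_one]
        exact confinesInversions_finRotate
      rw [hconf.ncard_forwardOrbit] at h
      omega
    have hw : popTA w ≠ w := fun hw => by
      rw [forwardOrbit_of_apply_eq hw, Set.ncard_singleton] at h
      omega
    rw [ncard_forwardOrbit_of_apply_ne (f := popTA) (fun _ => aexc_popTA_lt) hw] at h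
    have := ncard_forwardOrbit_popTA_le (popTA w)
    have := aexc_popTA_lt hw
    have := aexc_popTA_add_aexc_ncProjA w
    rw [aSplittable_iff]
    omega
  · intro h
    obtain ⟨hs, hS⟩ := (aSplittable_iff_cofactor hn).mp h
    have hconf := inv_eq_finRotate_mul_cofactor w ▸ hs.confinesInversions hS
    rw [hconf.ncard_forwardOrbit]
    have := (aSplittable_iff.mp h).1
    omega

end Splittable

section Counting

lemma card_filter_three_le (α : Type*) [Fintype α] :
    (Finset.univ.filter fun S : Finset α => 3 ≤ S.card).card +
      (1 + Fintype.card α + (Fintype.card α).choose 2) = 2 ^ Fintype.card α := by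
  classical
  have hsplit := Finset.card_filter_add_card_filter_not
    (s := (Finset.univ : Finset (Finset α))) (fun S => 3 ≤ S.card)
  have hsmall : (Finset.univ.filter fun S : Finset α => ¬ 3 ≤ S.card) =
      (Finset.range 3).biUnion fun k => Finset.powersetCard k Finset.univ := by
    ext S
    simp
  have hdisj : (↑(Finset.range 3) : Set ℕ).PairwiseDisjoint
      fun k => Finset.powersetCard k (Finset.univ : Finset α) :=
    fun _ _ _ _ hij => Finset.pairwise_disjoint_powersetCard _ hij
  rw [hsmall, Finset.card_biUnion hdisj] at hsplit
  simp only [Finset.card_powersetCard, Finset.sum_range_succ, Finset.sum_range_zero,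
    Finset.card_univ, Fintype.card_finset, Nat.choose_zero_right, Nat.choose_one_right] at hsplit
  omega

lemma pair_finRotate_injective (hn : 3 ≤ n) :
    Function.Injective fun i : Fin n => ({i, finRotate n i} : Finset (Fin n)) := by
  intro i j hij
  by_contra hne
  obtain ⟨hi, hj⟩ : finRotate n i = j ∧ finRotate n j = i := by
    simp only [← Finset.coe_inj, Finset.coe_pair, Set.pair_eq_pair_iff] at hij
    tauto
  have hdi := cdist_finRotate i
  have hdj := cdist_finRotate j
  have := cdist_add_comm hne
  rw [hi] at hdi
  rw [hj] at hdj
  omega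

lemma card_splittingSets (hn : 3 ≤ n) :
    (splittingSets n).card + (1 + n.choose 2) = 2 ^ n := by
  have hdisj : Disjoint (Finset.univ.filter fun S : Finset (Fin n) => 3 ≤ S.card)
      (Finset.univ.image fun i => {i, finRotate n i}) := by
    simp only [Finset.disjoint_left, Finset.mem_filter, Finset.mem_image, not_exists]
    rintro _ ⟨-, h⟩ i ⟨-, rfl⟩
    exact absurd (Finset.card_le_two (a := i) (b := finRotate n i)) (by omega)
  have hlarge := card_filter_three_le (Fin n)
  rw [Fintype.card_fin] at hlarge
  rw [splittingSets, Finset.card_union_of_disjoint hdisj,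
    Finset.card_image_of_injective _ (pair_finRotate_injective hn), Finset.card_univ,
    Fintype.card_fin]
  omega

lemma bijOn_support_cofactor (hn : 3 ≤ n) :
    Set.BijOn (fun w : Perm (Fin n) => (cofactor w).support) {w | ASplittable w}
      (splittingSets n) := by
  refine ⟨fun w hw => ((aSplittable_iff_cofactor hn).mp hw).2, fun w hw w' hw' h => ?_,
    fun S hS => ?_⟩
  · have hs : cofactor w = cofactor w' := ((aSplittable_iff_cofactor hn).mp hw).1.eq_of_support_eq
      ((aSplittable_iff_cofactor hn).mp hw').1 h
    rw [← inv_inj, inv_eq_finRotate_mul_cofactor, inv_eq_finRotate_mul_cofactor, hs]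
  · have hcard := two_le_card_of_mem_splittingSets (by omega) hS
    have hs : cofactor (finRotate n * setCycle S)⁻¹ = setCycle S := by
      rw [cofactor, mul_inv_rev, inv_inv, inv_mul_cancel_left]
    have hsupp : (cofactor (finRotate n * setCycle S)⁻¹).support = S := by
      rw [hs, support_setCycle hcard]
    refine ⟨(finRotate n * setCycle S)⁻¹, (aSplittable_iff_cofactor hn).mpr ⟨?_, ?_⟩, hsupp⟩
    · rw [hs]
      exact isIncreasingCycle_setCycle hcard
    · rwa [hsupp]

lemma ncard_aSplittable (hn : 3 ≤ n) :
    {w : Perm (Fin n) | ASplittable w}.ncard + (1 + n.choose 2) = 2 ^ n := by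
  rw [(bijOn_support_cofactor hn).ncard_eq, Set.ncard_coe_finset, card_splittingSets hn]

end Counting

end PopTsack

theorem theorem1p3 (n : ℕ) (hn : 3 ≤ n) :
    (∀ w : Equiv.Perm (Fin n),
      ((forwardOrbit popTA w).ncard : ℤ) = (n : ℤ) - 1 ↔ ASplittable w) ∧
    (({w : Equiv.Perm (Fin n) |
        ((forwardOrbit popTA w).ncard : ℤ) = (n : ℤ) - 1}.ncard : ℕ) : ℤ) =
      2 ^ n - (n.choose 2 : ℤ) - 1 := by
  have horbit := PopTsack.ncard_forwardOrbit_popTA_eq_sub_one_iff hn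
  refine ⟨horbit, ?_⟩
  have hcount := PopTsack.ncard_aSplittable hn
  simp only [horbit]
  zify at hcount
  linarith
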